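/- Let $X$ be a nonempty bounded complete metric space with metric $\mu$, let $D=\{d_0,\dots,d_{k-1}\}$ be a finite set of contractions of $X$ with $\bigcup_{d\in D}d[X]=X$, and let $Q=\{u_0,u_1,\dots\}$ be a countable dense subset of $X$ (the *basic elements*; below, procedures operate on indices of basic elements, on the letters for the digits $d\in D$, and on codes of rational numbers). Assume that $(X,D,Q)$ is * a *computable digit space*: the sets $\{(u,v,r)\in Q\times Q\times\mathbb{Q}\mid \mu(u,v)<r\}$ and $\{(u,v,r)\in Q\times Q\times\mathbb{Q}\mid \mu(u,v)>r\}$ are effectively enumerable, and every $d\in D$ is computable, i.e. it has a computable modulus of uniform continuity, and there is a procedure that given $u\in Q$ and $n\in\mathbb{N}$ computes some $v\in Q$ with $\mu(d(u),v)<2^{-n}$; * *well-covering*: every $x\in X$ lies in the interior of $d[X]$ for some $d\in D$; * *decidable*: for $u\in Q$, $\theta\in\mathbb{Q}_{>0}$ and $d\in D$ it is decidable whether the open ball $B_\mu(u,\theta)$ is contained in $d[X]$; * *equipped with approximable choice*: for every $d\in D$ there is an effective procedure that maps $\theta\in\mathbb{Q}_{>0}$ and $u\in d[X]\cap Q$ to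 some $v^\theta_u\in Q$ such that (1) $\mu(v^\theta_u,v^{\bar\theta}_u)<\max\{\theta,\bar\theta\}$ for all $\theta,\bar\theta$ and $u$; (2) from $\theta$ one can compute $\theta'\in\mathbb{Q}_{>0}$ such that for all $u,u'\in d[X]\cap Q$, $\mu(u,u')<\theta'$ implies $\mu(v^\theta_u,v^\theta_{u'})<\theta$; (3) for all $\theta$ and $u$ there is $z\in X$ with $d(z)=u$ and $\mu(z,v^\theta_u)<\theta$. Let $\mathrm{K}(X)$ be the set of nonempty compact subsets of $X$ with the Hausdorff metric $\mu_{\mathrm H}$, and call the nonempty finite subsets of $Q$ *basic sets*. Let $\mathrm{A}_{\mathrm K}$ be the set of all $K\in\mathrm{K}(X)$ such that for every $n\in\mathbb{N}$ there is a basic set $U$ with $\mu_{\mathrm H}(K,U)<2^{-n}$. Let $\mathrm{C}_{\mathrm K}$ be the largest subset of $\mathrm{K}(X)$ such that every $A\in\mathrm{C}_{\mathrm K}$ is of the form $A=\bigcup_{d\in E}d[A_d]$ for some $E\subseteq D$ and some $A_d\in\mathrm{C}_{\mathrm K}$ ($d\in E$). A *digital tree* is a set $T$ of finite sequences of digits that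 contains the empty sequence, is closed under prefixes, and in which every element $[e_1,\dots,e_n]\in T$ has an extension $[e_1,\dots,e_n,e]\in T$ with $e\in D$. Its *value* is $\bigcap_{n\in\mathbb{N}}\bigcup\{(e_1\circ\cdots\circ e_n)[X]\mid [e_1,\dots,e_n]\in T\}$. Then $\mathrm{A}_{\mathrm K}\subseteq\mathrm{C}_{\mathrm K}$, and this inclusion is effective: there is a computable operator $J$ that maps every sequence $(C_n)_{n\in\mathbb{N}}$ of basic sets for which there is some $K\in\mathrm{K}(X)$ with $\mu_{\mathrm H}(C_n,K)<2^{-n}$ for all $n$ to (a decision procedure for) a digital tree whose value is $K$. Here $J$ is a *computable operator* if one partial recursive procedure decides, uniformly in the sequence $(C_n)$ and a finite sequence $\vec e$ of digits, whether $\vec e\in J((C_n)_n)$, each time using only a finite initial segment of $(C_n)$. -/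

import Mathlib

open Set TopologicalSpace

/-! Digit spaces `(X, D)` with `D = {dig 0, …, dig (k-1)}` and basic elements `u 0, u 1, …`.
Basic elements are handled through their indices, digits through their letters in `Fin k`. -/

namespace DigitSpace

/-- The standard numbering `⟨a, b, c⟩ ↦ (a - b) / (c + 1)` of the rational numbers. -/
noncomputable def ratOf (p : ℕ × ℕ × ℕ) : ℝ := ((p.1 : ℝ) - (p.2.1 : ℝ)) / ((p.2.2 : ℝ) + 1)

/-- The standard numbering `⟨a, b⟩ ↦ (a + 1) / (b + 1)` of the positive rational numbers. -/
noncomputable def posRat (p : ℕ × ℕ) : ℝ := ((p.1 : ℝ) + 1) / ((p.2 : ℝ) + 1)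

theorem exists_ratOf (r : ℚ) : ∃ p, ratOf p = (r : ℝ) := by
  refine ⟨(r.num.toNat, (-r.num).toNat, r.den - 1), ?_⟩
  have h1 : ((r.num.toNat : ℝ) - ((-r.num).toNat : ℝ)) = (r.num : ℝ) := by
    exact_mod_cast Int.toNat_sub_toNat_neg r.num
  have h2 : (((r.den - 1 : ℕ) : ℝ) + 1) = (r.den : ℝ) := by
    exact_mod_cast Nat.sub_add_cancel r.pos
  rw [ratOf, h1, h2]
  exact (Rat.cast_def r).symm

theorem exists_posRat (r : ℚ) (hr : 0 < r) : ∃ p, posRat p = (r : ℝ) := by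
  refine ⟨(r.num.toNat - 1, r.den - 1), ?_⟩
  have hn : 0 < r.num := Rat.num_pos.mpr hr
  have h1 : (((r.num.toNat - 1 : ℕ) : ℝ) + 1) = (r.num : ℝ) := by
    have h3 : (((r.num.toNat - 1 : ℕ) : ℤ) + 1) = r.num := by omega
    exact_mod_cast h3
  have h2 : (((r.den - 1 : ℕ) : ℝ) + 1) = (r.den : ℝ) := by
    exact_mod_cast Nat.sub_add_cancel r.pos
  rw [posRat, h1, h2]
  exact (Rat.cast_def r).symm

/-! ### Computability of operators on infinite sequences -/

/-- The finite initial segment `[p 0, …, p (n-1)]`. -/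
def initSeg {α : Type*} (p : ℕ → α) (n : ℕ) : List α := (List.range n).map p

/-- `J`, which maps infinite sequences to functions, is a computable operator on the set `S` of
sequences: one partial recursive function `F` computes, uniformly in `p ∈ S`, every value `J p x`
from finite initial segments of `p` (and never gives a wrong answer). -/
def ComputableOperatorOn {α β γ : Type*} [Primcodable α] [Primcodable β] [Primcodable γ]
    (S : Set (ℕ → α)) (J : (ℕ → α) → β → γ) : Prop :=
  ∃ F : List α × β →. γ, Partrec F ∧ ∀ p ∈ S, ∀ x : β,
    (∃ n, J p x ∈ F (initSeg p n, x)) ∧ ∀ n, ∀ y ∈ F (initSeg p n, x), y = J p x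

section

variable {X : Type*} [MetricSpace X] {k : ℕ}

/-! ### Digit spaces -/

/-- `X` is a nonempty bounded complete metric space and the `dig i` are finitely many contractions
that cover `X`. -/
structure IsDigitSpace (dig : Fin k → X → X) : Prop where
  nonempty : Nonempty X
  bounded : ∃ M : ℝ, ∀ x y : X, dist x y ≤ M
  complete : CompleteSpace X
  contraction : ∀ i, ∃ q : ℝ, q < 1 ∧ ∀ x y, dist (dig i x) (dig i y) ≤ q * dist x y
  cover : ⋃ i, range (dig i) = univ

/-- Every point lies in the interior of the range of some digit. -/
def WellCovering (dig : Fin k → X → X) : Prop := ∀ x, ∃ i, x ∈ interior (range (dig i))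

/-- `u` enumerates a dense subset, and `μ(u i, u j) < r`, `μ(u i, u j) > r` are effectively
enumerable. -/
structure IsComputableMetric (u : ℕ → X) : Prop where
  dense : DenseRange u
  lt : REPred fun p : ℕ × ℕ × (ℕ × ℕ × ℕ) => dist (u p.1) (u p.2.1) < ratOf p.2.2
  gt : REPred fun p : ℕ × ℕ × (ℕ × ℕ × ℕ) => dist (u p.1) (u p.2.1) > ratOf p.2.2

/-- `Φ` has a computable modulus of uniform continuity, and its values at basic elements can be
computed to any precision. -/
structure IsComputableMap (u : ℕ → X) (Φ : X → X) : Prop where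
  modulus : ∃ m : ℕ → ℕ, Computable m ∧
    ∀ n x y, dist x y < (2 : ℝ)⁻¹ ^ m n → dist (Φ x) (Φ y) < (2 : ℝ)⁻¹ ^ n
  approx : ∃ g : ℕ × ℕ → ℕ, Computable g ∧ ∀ i n, dist (Φ (u i)) (u (g (i, n))) < (2 : ℝ)⁻¹ ^ n

/-- Computable digit spaces `(X, D, Q)`. -/
structure IsComputableDigitSpace (dig : Fin k → X → X) (u : ℕ → X) : Prop where
  digitSpace : IsDigitSpace dig
  metric : IsComputableMetric u
  digits : ∀ i, IsComputableMap u (dig i)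

/-- It is decidable whether the open ball `B(u j, θ)` is contained in the range of a digit. -/
def IsDecidable (dig : Fin k → X → X) (u : ℕ → X) : Prop :=
  ComputablePred fun p : ℕ × (ℕ × ℕ) × Fin k =>
    Metric.ball (u p.1) (posRat p.2.1) ⊆ range (dig p.2.2)

/-- For every digit `d` there is an effective procedure `v`, defined at least for those `(θ, u j)`
with `u j ∈ d[X]`, which approximates preimages under `d`. -/
def ApproximableChoice (dig : Fin k → X → X) (u : ℕ → X) : Prop :=
  ∀ i : Fin k, ∃ v : (ℕ × ℕ) × ℕ →. ℕ, Partrec v ∧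
    (∀ θ j, u j ∈ range (dig i) → (v (θ, j)).Dom) ∧
    (∀ θ θ' j, u j ∈ range (dig i) → ∀ a ∈ v (θ, j), ∀ b ∈ v (θ', j),
      dist (u a) (u b) < max (posRat θ) (posRat θ')) ∧
    (∃ m : ℕ × ℕ → ℕ × ℕ, Computable m ∧
      ∀ θ j j', u j ∈ range (dig i) → u j' ∈ range (dig i) →
        dist (u j) (u j') < posRat (m θ) →
        ∀ a ∈ v (θ, j), ∀ b ∈ v (θ, j'), dist (u a) (u b) < posRat θ) ∧
    (∀ θ j, u j ∈ range (dig i) → ∀ a ∈ v (θ, j), ∃ z, dig i z = u j ∧ dist z (u a) < posRat θ)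

/-! ### Basic sets and the predicates `A_K`, `C_K` -/

/-- The finite set of basic elements whose indices are listed in `l`. -/
def basicSet (u : ℕ → X) (l : List ℕ) : Set X := {x | ∃ j ∈ l, x = u j}

/-- `A_K`: the nonempty compact sets that are, for every `n`, within Hausdorff distance `2⁻ⁿ` of a
nonempty finite set of basic elements. -/
def AK (u : ℕ → X) : Set (NonemptyCompacts X) :=
  {K | ∀ n : ℕ, ∃ l : List ℕ, l ≠ [] ∧
    Metric.hausdorffDist (K : Set X) (basicSet u l) < (2 : ℝ)⁻¹ ^ n}

/-- A realizer of `K ∈ A_K`: a sequence `C` of nonempty finite sets of basic elements (given by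
lists of indices) with `μ_H(K, C n) < 2⁻ⁿ`. -/
def IsHausdorffName (u : ℕ → X) (C : ℕ → List ℕ) (K : NonemptyCompacts X) : Prop :=
  ∀ n : ℕ, C n ≠ [] ∧ Metric.hausdorffDist (K : Set X) (basicSet u (C n)) < (2 : ℝ)⁻¹ ^ n

/-- The clause that defines `C_K` coinductively. -/
def CKStep (dig : Fin k → X → X) (S : Set (NonemptyCompacts X)) (A : NonemptyCompacts X) : Prop :=
  ∃ (E : Set (Fin k)) (B : E → NonemptyCompacts X),
    (A : Set X) = ⋃ d : E, dig d '' (B d : Set X) ∧ ∀ d : E, B d ∈ S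

/-- `C_K`: the largest set `S` of nonempty compact sets all of whose members satisfy `CKStep S`. -/
def CK (dig : Fin k → X → X) : Set (NonemptyCompacts X) :=
  ⋃₀ {S | ∀ A ∈ S, CKStep dig S A}

theorem CK_isGreatest (dig : Fin k → X → X) :
    IsGreatest {S : Set (NonemptyCompacts X) | ∀ A ∈ S, CKStep dig S A} (CK dig) := by
  refine ⟨?_, fun S hS => subset_sUnion_of_mem hS⟩
  rintro A ⟨S, hS, hA⟩
  obtain ⟨E, B, h1, h2⟩ := hS A hA
  exact ⟨E, B, h1, fun d => ⟨S, hS, h2 d⟩⟩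

/-! ### Digital trees -/

/-- A nonempty prefix-closed set of finite digit sequences without maximal element. -/
structure IsDigitalTree (T : Set (List (Fin k))) : Prop where
  nil_mem : [] ∈ T
  prefix_mem : ∀ w i, w ++ [i] ∈ T → w ∈ T
  extend : ∀ w ∈ T, ∃ i, w ++ [i] ∈ T

/-- The composition `d₀ ∘ ⋯ ∘ dₙ₋₁` of the digits in a word `[d₀, …, dₙ₋₁]`. -/
def wordMap (dig : Fin k → X → X) : List (Fin k) → X → X
  | [] => id
  | i :: w => dig i ∘ wordMap dig w

/-- The value `⋂ n, ⋃ {w[X] | w ∈ T, |w| = n}` of a digital tree. -/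
def treeValue (dig : Fin k → X → X) (T : Set (List (Fin k))) : Set X :=
  ⋂ n : ℕ, ⋃ w ∈ {w | w ∈ T ∧ w.length = n}, range (wordMap dig w)

end

end DigitSpace

/-! The digits are contractions covering the bounded complete space `X`, so words of length `n` cut
`X` into finitely many pieces of uniformly small diameter and `X` is compact (`compactSpace`). The
inclusion of A_K in C_K is then plain coinduction: every nonempty compact `A` is the union of the
sets d[d⁻¹[A]] (`CK_eq_univ`).

For the effective part, a word is accepted only when its range is certain to meet `K`. By
well-covering and a Lebesgue number, every ball of one fixed small radius lies in the range of some
digit, so a decidable ball test always finds a next digit. A word of length `n` is accepted when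
there is a chain of basic elements j₀, …, jₙ, taken from sufficiently late members of the name of
`K`, whose neighbours are close and for which the approximate preimage of each jᵢ (i < n) under the
first i digits passes the test for the next digit.

Tolerances at least halve along the chain, so a point of `K` near jₙ is near every jᵢ, and the tests
apply to it as well (`pullable_of_mem_nodes`). Approximable choice converges to exact preimages
(`exists_preimage_of_approx`), so this point lies in the range of the word. Each point of `K` is
followed by chains of every length, hence `K` is contained in the value. Conversely, ranges of
accepted words meet `K` and shrink, and `K` is closed, so the value is contained in `K`. -/

section Computability

/-! ### Closure properties of computable functions -/

variable {α β σ : Type*} [Primcodable α] [Primcodable β] [Primcodable σ]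

/-- Recursion on `n` computes the fold over the first `n` entries; an index past the end leaves the
state unchanged. -/
theorem Computable.list_foldl {f : α → List β} {g : α → σ} {h : α → σ × β → σ}
    (hf : Computable f) (hg : Computable g) (hh : Computable₂ h) :
    Computable fun a => (f a).foldl (fun s b => h a (s, b)) (g a) := by
  have step : Computable₂ fun (a : α) (p : ℕ × σ) =>
      (Option.casesOn (motive := fun _ => σ) ((f a)[p.1]?) p.2 fun b => h a (p.2, b) : σ) :=
    Computable.option_casesOn
      (Computable.list_getElem?.comp (hf.comp .fst) (Computable.fst.comp .snd))
      (Computable.snd.comp .snd)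
      (hh.comp (Computable.fst.comp .fst)
        ((Computable.snd.comp (Computable.snd.comp .fst)).pair .snd))
  have key : ∀ a n, Nat.rec (motive := fun _ => σ) (g a) (fun i s =>
      (Option.casesOn (motive := fun _ => σ) ((f a)[i]?) s fun b => h a (s, b) : σ)) n =
      ((f a).take n).foldl (fun s b => h a (s, b)) (g a) := by
    intro a n
    induction n with
    | zero => simp
    | succ n ih =>
      rw [List.take_add_one, List.foldl_append, ← ih]
      cases h : (f a)[n]? <;> simp [h]
  refine (Computable.nat_rec (Computable.list_length.comp hf) hg step).of_eq fun a => ?_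
  simpa using key a (f a).length

theorem Computable.list_foldr {f : α → List β} {g : α → σ} {h : α → β × σ → σ}
    (hf : Computable f) (hg : Computable g) (hh : Computable₂ h) :
    Computable fun a => (f a).foldr (fun b s => h a (b, s)) (g a) :=
  (Computable.list_foldl (Computable.list_reverse.comp hf) hg
    (hh.comp Computable.fst (Computable.pair (Computable.snd.comp .snd)
      (Computable.fst.comp .snd))).to₂).of_eq fun a => by
    simp [List.foldl_reverse]

/-- A right fold does not see the tail, so the state carries a rebuilt copy of the tail next to the
value. -/
theorem Computable.list_rec {f : α → List β} {g : α → σ} {h : α → β × List β × σ → σ}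
    (hf : Computable f) (hg : Computable g) (hh : Computable₂ h) :
    @Computable _ σ _ _ fun a => List.recOn (f a) (g a) fun b l IH => h a (b, l, IH) :=
  let F (a : α) := (f a).foldr (fun (b : β) (s : List β × σ) => (b :: s.1, h a (b, s))) ([], g a)
  have : Computable F :=
    Computable.list_foldr hf ((Computable.const []).pair hg)
      (((Computable.list_cons.comp Computable.fst (Computable.fst.comp .snd)).comp
        Computable.snd).pair hh).to₂
  (Computable.snd.comp this).of_eq fun a => by
    suffices F a = (f a, List.recOn (f a) (g a) fun b l IH => h a (b, l, IH)) by rw [this]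
    dsimp [F]
    induction f a <;> simp [*]

theorem Computable.list_filter {f : α → List β} {p : α → β → Bool}
    (hf : Computable f) (hp : Computable₂ p) : Computable fun a => (f a).filter (p a) :=
  (Computable.list_foldr hf (Computable.const [])
    (Computable.cond (hp.comp Computable.fst (Computable.fst.comp .snd))
      (Computable.list_cons.comp (Computable.fst.comp .snd) (Computable.snd.comp .snd))
      (Computable.snd.comp .snd)).to₂).of_eq fun a => by
    induction f a with
    | nil => rfl
    | cons b l ih => cases h : p a b <;> simp [ih, h]

theorem Computable.list_any {f : α → List β} {p : α → β → Bool}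
    (hf : Computable f) (hp : Computable₂ p) : Computable fun a => (f a).any (p a) :=
  (Computable.list_foldr hf (Computable.const false)
    (Computable.cond (hp.comp Computable.fst (Computable.fst.comp .snd))
      (Computable.const true) (Computable.snd.comp .snd)).to₂).of_eq fun a => by
    induction f a with
    | nil => rfl
    | cons b l ih => cases h : p a b <;> simp_all

theorem Computable.nat_iterate {f : α → α} (hf : Computable f) :
    Computable₂ fun (n : ℕ) (a : α) => f^[n] a :=
  (Computable.nat_rec Computable.fst Computable.snd
    (hf.comp (Computable.snd.comp .snd)).to₂).of_eq fun p => by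
    obtain ⟨n, a⟩ := p
    induction n with
    | zero => rfl
    | succ n ih =>
      simp only [Function.iterate_succ_apply'] at ih ⊢
      rw [ih]

/-- Finitely many partial recursive functions are uniformly partial recursive. -/
theorem Partrec.of_finite_family {ι : Type*} [Primcodable ι] [Finite ι] {f : ι → α →. σ}
    (hf : ∀ i, Partrec (f i)) : Partrec fun p : ι × α => f p.1 p.2 := by
  choose c hc using fun i => Nat.Partrec.Code.exists_code.1 (hf i)
  -- The choice of codes is a function on a finite type, hence primitive recursive, so one universal
  -- evaluation serves all indices.
  have h1 : Partrec fun p : ι × α => (c p.1).eval (Encodable.encode p.2) :=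
    Nat.Partrec.Code.eval_part.comp ((Primrec.dom_finite c).to_comp.comp .fst)
      (Computable.encode.comp .snd)
  have h2 : Partrec₂ fun (_ : ι × α) (n : ℕ) => (Encodable.decode (α := σ) n : Part σ) :=
    (Computable.ofOption (Computable.decode.comp .snd)).to₂
  refine (h1.bind h2).of_eq fun p => ?_
  simp only [hc, Encodable.encodek, Part.coe_some, Part.bind_some, Part.bind_map, Part.bind_some_right]

/-- Two effectively enumerable predicates that cover everything admit a computable selector. -/
theorem REPred.exists_computable_selector {p q : α → Prop} (hp : REPred p) (hq : REPred q)
    (h : ∀ a, p a ∨ q a) :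
    ∃ f : α → Bool, Computable f ∧ ∀ a, (f a = true → p a) ∧ (f a = false → q a) := by
  -- Both enumerations run in parallel, and the answer is the label of one that halts.
  obtain ⟨r, hr, H⟩ := Partrec.merge'
    (hp.map (Computable.const true).to₂) (hq.map (Computable.const false).to₂)
  have hdom : ∀ a, (r a).Dom := fun a => by
    refine (H a).2.2 ?_
    simpa [Part.assert] using h a
  refine ⟨fun a => (r a).get (hdom a), hr.of_eq_tot fun a => Part.get_mem _, fun a => ?_⟩
  have := (H a).1 _ (Part.get_mem (hdom a))
  constructor <;> intro e <;> dsimp only at e <;> rw [e] at this <;> simpa using this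

end Computability

namespace DigitSpace

/-! ### Tolerances and the decision procedure -/

/-- The tolerance `1 / (n + 1)`. -/
noncomputable def tol (n : ℕ) : ℝ := 1 / ((n : ℝ) + 1)

theorem tol_pos (n : ℕ) : 0 < tol n := by unfold tol; positivity

theorem tol_anti {m n : ℕ} (h : m ≤ n) : tol n ≤ tol m := by
  unfold tol
  have : (m : ℝ) ≤ n := by exact_mod_cast h
  gcongr

theorem tol_le_half {m n : ℕ} (h : 2 * n + 1 ≤ m) : tol m ≤ tol n / 2 := by
  refine (tol_anti h).trans_eq ?_
  unfold tol
  push_cast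
  field_simp
  ring

theorem exists_tol_lt {r : ℝ} (hr : 0 < r) : ∃ n, tol n < r := exists_nat_one_div_lt hr

/-- This is m < 2ᵐ at m = 8(n + 1); it accounts for the form of `nameIdx`. -/
theorem two_inv_pow_le_tol (n : ℕ) : (2 : ℝ)⁻¹ ^ (8 * n + 8) ≤ tol n / 8 := by
  have h : ((8 * n + 8 : ℕ) : ℝ) ≤ 2 ^ (8 * n + 8) := by exact_mod_cast Nat.lt_two_pow_self.le
  have h2 : tol n / 8 = ((8 * n + 8 : ℕ) : ℝ)⁻¹ := by
    unfold tol
    push_cast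
    field_simp
  rw [inv_pow, h2]
  exact inv_anti₀ (by positivity) h

/-- The procedures from which membership in the digital tree of a compact set is decided:
approximate preimages `choice (d, n, j)` of the basic element `j` under the digit `d`, a modulus of
continuity for them, a test whether a neighbourhood of fixed size lies in the range of a digit, and
an approximate comparison of distances. -/
structure Procedures (k : ℕ) where
  choice : Fin k × ℕ × ℕ → ℕ
  modulus : ℕ → ℕ
  inside : ℕ × Fin k → Bool
  close : ℕ × ℕ × ℕ → Bool
  base : ℕ

namespace Procedures

variable {X : Type*} [MetricSpace X] {k : ℕ}

/-- The tolerance index to which points are known after `n` steps. -/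
def prec (A : Procedures k) (n : ℕ) : ℕ := A.modulus^[n] A.base

/-- The position of the finite set used in step `n`. -/
def nameIdx (A : Procedures k) (n : ℕ) : ℕ := 8 * A.prec n + 8

/-- Successive approximate preimages of the basic element `j` under the digits of a word, which is
given in reverse. -/
def lift (A : Procedures k) (N : ℕ) : List (Fin k) → ℕ → ℕ
  | [], j => j
  | d :: t, j => A.choice (d, A.prec (N - 1 - t.length), A.lift N t j)

/-- The end points of the chains of basic elements that witness that a word, given in reverse,
belongs to the tree. -/
def nodes (A : Procedures k) (C : ℕ → List ℕ) : List (Fin k) → List ℕ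
  | [] => C (A.nameIdx 0)
  | d :: t => (C (A.nameIdx (t.length + 1))).filter fun i =>
      (A.nodes C t).any fun j => A.inside (A.lift t.length t j, d) && A.close (j, i, A.prec t.length)

/-- The decision procedure for the digital tree. -/
def tree (A : Procedures k) (C : ℕ → List ℕ) (w : List (Fin k)) : Bool :=
  (A.nodes C w.reverse).any fun _ => true

theorem tree_eq_true {A : Procedures k} {C : ℕ → List ℕ} {w : List (Fin k)} :
    A.tree C w = true ↔ ∃ j, j ∈ A.nodes C w.reverse := by
  simp [tree]

theorem mem_nodes_cons {A : Procedures k} {C : ℕ → List ℕ} {d : Fin k} {t : List (Fin k)} {i : ℕ} :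
    i ∈ A.nodes C (d :: t) ↔ i ∈ C (A.nameIdx (t.length + 1)) ∧ ∃ j ∈ A.nodes C t,
      A.inside (A.lift t.length t j, d) = true ∧ A.close (j, i, A.prec t.length) = true := by
  simp [nodes]

theorem mem_of_mem_nodes {A : Procedures k} {C : ℕ → List ℕ} {t : List (Fin k)} {i : ℕ}
    (h : i ∈ A.nodes C t) : i ∈ C (A.nameIdx t.length) := by
  cases t with
  | nil => exact h
  | cons d t => exact (mem_nodes_cons.1 h).1

theorem prec_succ (A : Procedures k) (n : ℕ) : A.prec (n + 1) = A.modulus (A.prec n) :=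
  Function.iterate_succ_apply' _ _ _

/-- The finite use of the name: a word of length `n` consults only the first `n + 1` positions given
by `nameIdx`. -/
theorem nodes_congr (A : Procedures k) {C C' : ℕ → List ℕ} (t : List (Fin k))
    (h : ∀ n ≤ t.length, C (A.nameIdx n) = C' (A.nameIdx n)) : A.nodes C t = A.nodes C' t := by
  induction t with
  | nil => exact h 0 le_rfl
  | cons d t ih =>
    rw [nodes, nodes, ih fun n hn => h n (hn.trans (Nat.le_succ _)), h (t.length + 1) le_rfl]

/-! ### Computability of the tree -/

/-- The components of `A` are computable. -/
structure IsComputable (A : Procedures k) : Prop where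
  choice : Computable A.choice
  modulus : Computable A.modulus
  inside : Computable A.inside
  close : Computable A.close

namespace IsComputable

variable {A : Procedures k}

theorem prec (hA : A.IsComputable) : Computable A.prec :=
  (Computable.nat_iterate hA.modulus).comp .id (.const _)

theorem nameIdx (hA : A.IsComputable) : Computable A.nameIdx := by
  have h : Computable fun n : ℕ => 8 * n + 8 :=
    (Primrec.nat_add.comp (Primrec.nat_mul.comp (.const 8) .id) (.const 8)).to_comp
  exact h.comp hA.prec

theorem lift (hA : A.IsComputable) :
    Computable fun p : ℕ × List (Fin k) × ℕ => A.lift p.1 p.2.1 p.2.2 := by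
  have hsub : Computable fun q : (ℕ × List (Fin k) × ℕ) × (Fin k × List (Fin k) × ℕ) =>
      q.1.1 - 1 - q.2.2.1.length :=
    Primrec.nat_sub.to_comp.comp
      (Primrec.nat_sub.to_comp.comp (Computable.fst.comp .fst) (.const 1))
      (Computable.list_length.comp (Computable.fst.comp (Computable.snd.comp .snd)))
  have step : Computable₂ fun (p : ℕ × List (Fin k) × ℕ) (q : Fin k × List (Fin k) × ℕ) =>
      A.choice (q.1, A.prec (p.1 - 1 - q.2.1.length), q.2.2) :=
    hA.choice.comp ((Computable.fst.comp .snd).pair ((hA.prec.comp hsub).pair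
      (Computable.snd.comp (Computable.snd.comp .snd))))
  refine (Computable.list_rec (Computable.fst.comp .snd) (Computable.snd.comp .snd) step).of_eq
    fun ⟨N, t, j⟩ => ?_
  induction t with
  | nil => rfl
  | cons d t ih => exact congrArg (fun i => A.choice (d, A.prec (N - 1 - t.length), i)) ih

theorem nodes (hA : A.IsComputable) :
    Computable fun p : List (List ℕ) × List (Fin k) => A.nodes (fun i => (p.1[i]?).getD []) p.2 := by
  have hget {α : Type} [Primcodable α] {f : α → List (List ℕ)} {g : α → ℕ}
      (hf : Computable f) (hg : Computable g) : Computable fun a => ((f a)[A.nameIdx (g a)]?).getD [] :=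
    Computable.option_getD (Computable.list_getElem?.comp hf (hA.nameIdx.comp hg)) (.const [])
  have test : Computable₂ fun
      (q : ((List (List ℕ) × List (Fin k)) × (Fin k × List (Fin k) × List ℕ)) × ℕ) (j : ℕ) =>
      (A.inside (A.lift q.1.2.2.1.length q.1.2.2.1 j, q.1.2.1) &&
        A.close (j, q.2, A.prec q.1.2.2.1.length)) := by
    have ht : Computable fun
        r : (((List (List ℕ) × List (Fin k)) × (Fin k × List (Fin k) × List ℕ)) × ℕ) × ℕ =>
        r.1.1.2.2.1 :=
      Computable.fst.comp (Computable.snd.comp (Computable.snd.comp (Computable.fst.comp .fst)))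
    have hl := Computable.list_length.comp ht
    exact Primrec.and.to_comp.comp
      (hA.inside.comp ((hA.lift.comp (hl.pair (ht.pair .snd))).pair
        (Computable.fst.comp (Computable.snd.comp (Computable.fst.comp .fst)))))
      (hA.close.comp (Computable.snd.pair
        ((Computable.snd.comp .fst).pair (hA.prec.comp hl))))
  have step : Computable₂ fun
      (p : List (List ℕ) × List (Fin k)) (q : Fin k × List (Fin k) × List ℕ) =>
      ((p.1[A.nameIdx (q.2.1.length + 1)]?).getD []).filter fun i =>
        q.2.2.any fun j => A.inside (A.lift q.2.1.length q.2.1 j, q.1) &&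
          A.close (j, i, A.prec q.2.1.length) :=
    Computable.list_filter
      (hget (Computable.fst.comp .fst) (Computable.succ.comp (Computable.list_length.comp
        (Computable.fst.comp (Computable.snd.comp .snd)))))
      (Computable.list_any (Computable.snd.comp (Computable.snd.comp (Computable.snd.comp .fst)))
        test).to₂
  refine (Computable.list_rec .snd (hget .fst (.const 0)) step).of_eq fun ⟨l, t⟩ => ?_
  induction t with
  | nil => rfl
  | cons d t ih =>
    exact congrArg (fun s : List ℕ => ((l[A.nameIdx (t.length + 1)]?).getD []).filter fun i =>
      s.any fun j => A.inside (A.lift t.length t j, d) && A.close (j, i, A.prec t.length)) ih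

end IsComputable

theorem computableOperatorOn_tree {A : Procedures k} (hA : A.IsComputable)
    (hmod : ∀ n, n ≤ A.modulus n) (S : Set (ℕ → List ℕ)) : ComputableOperatorOn S A.tree := by
  have hmono : Monotone A.nameIdx := by
    refine monotone_nat_of_le_succ fun n => ?_
    have := hmod (A.prec n)
    rw [nameIdx, nameIdx, prec_succ]
    omega
  -- The procedure answers only when the segment reaches beyond the last position consulted, so the
  -- default `[]` for missing entries never affects an answer.
  have hb : Computable fun x : List (List ℕ) × List (Fin k) =>
      decide (A.nameIdx x.2.length < x.1.length) :=
    Primrec.nat_lt.decide.to_comp.comp (hA.nameIdx.comp (Computable.list_length.comp .snd))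
      (Computable.list_length.comp .fst)
  have ht : Computable fun x : List (List ℕ) × List (Fin k) =>
      A.tree (fun i => (x.1[i]?).getD []) x.2 :=
    Computable.list_any (hA.nodes.comp (Computable.fst.pair (Computable.list_reverse.comp .snd)))
      (Computable.const true).to₂
  have hF := Computable.ofOption
    (Computable.cond hb (Computable.option_some.comp ht) (.const none))
  have key : ∀ (p : ℕ → List ℕ) (w : List (Fin k)) n, A.nameIdx w.length < n →
      A.tree (fun i => ((initSeg p n)[i]?).getD []) w = A.tree p w := by
    intro p w n hn
    unfold tree
    rw [A.nodes_congr w.reverse fun m hm => ?_]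
    have hm' : A.nameIdx m < n := (hmono (by simpa using hm)).trans_lt hn
    simp [initSeg, List.getElem?_range hm']
  refine ⟨_, hF, fun p _ w => ⟨⟨A.nameIdx w.length + 1, ?_⟩, fun n y hy => ?_⟩⟩
  · rw [key p w _ (Nat.lt_succ_self _)]
    simp [initSeg]
  · by_cases hn : A.nameIdx w.length < n
    · rw [key p w n hn] at hy
      simpa [initSeg, hn] using hy
    · simp [initSeg, hn] at hy

/-! ### Correctness of the tree -/

/-- The specification of the components of `A`, relative to exact right inverses `s d` of the
digits. -/
structure IsCorrect (A : Procedures k) (dig : Fin k → X → X) (u : ℕ → X) (s : Fin k → X → X)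
    (ρ : ℝ) : Prop where
  section_eq : ∀ d x, Metric.ball x ρ ⊆ range (dig d) → dig d (s d x) = x
  choice : ∀ d n j x, Metric.ball x ρ ⊆ range (dig d) → A.base ≤ n →
    dist (u j) x < tol (A.modulus n) → dist (u (A.choice (d, n, j))) (s d x) < tol n
  modulus : ∀ n, 2 * n + 1 ≤ A.modulus n
  inside : ∀ j d, A.inside (j, d) = true → ∀ x, dist (u j) x < tol A.base →
    Metric.ball x ρ ⊆ range (dig d)
  exists_inside : ∀ j, ∃ d, A.inside (j, d) = true
  close : ∀ i j n, A.close (i, j, n) = true → dist (u i) (u j) < tol n / 2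
  close_eq_true : ∀ i j n, dist (u i) (u j) ≤ tol n / 4 → A.close (i, j, n) = true

/-- The iterated right inverse along a word given in reverse. -/
def pull (s : Fin k → X → X) : List (Fin k) → X → X
  | [], x => x
  | d :: t, x => s d (pull s t x)

/-- The iterated right inverses are defined, with some room, along a word given in reverse. -/
def Pullable (dig s : Fin k → X → X) (ρ : ℝ) : List (Fin k) → X → Prop
  | [], _ => True
  | d :: t, x => Pullable dig s ρ t x ∧ Metric.ball (pull s t x) ρ ⊆ range (dig d)

theorem wordMap_concat {Y : Type*} (dig : Fin k → Y → Y) (w : List (Fin k)) (d : Fin k) (x : Y) :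
    wordMap dig (w ++ [d]) x = wordMap dig w (dig d x) := by
  induction w with
  | nil => rfl
  | cons e w ih => exact congrArg (dig e) ih

namespace IsCorrect

variable {A : Procedures k} {dig : Fin k → X → X} {u : ℕ → X} {s : Fin k → X → X} {ρ : ℝ}

theorem wordMap_pull (hA : A.IsCorrect dig u s ρ) {t : List (Fin k)} {x : X}
    (h : Pullable dig s ρ t x) : wordMap dig t.reverse (pull s t x) = x := by
  induction t with
  | nil => rfl
  | cons d t ih =>
    rw [List.reverse_cons, wordMap_concat, pull, hA.section_eq _ _ h.2, ih h.1]

theorem base_le_prec (hA : A.IsCorrect dig u s ρ) (n : ℕ) : A.base ≤ A.prec n := by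
  induction n with
  | zero => exact le_rfl
  | succ n ih =>
    have := hA.modulus (A.prec n)
    rw [prec_succ]
    omega

theorem tol_prec_succ (hA : A.IsCorrect dig u s ρ) (n : ℕ) :
    tol (A.prec (n + 1)) ≤ tol (A.prec n) / 2 := by
  rw [prec_succ]
  exact tol_le_half (hA.modulus _)

/-- Each approximate preimage costs one application of `modulus`, and `prec` is the iterate of
`modulus`. After `N` digits the accuracy left is that of `base`, which is what the range test needs.
-/
theorem dist_lift (hA : A.IsCorrect dig u s ρ) {N j : ℕ} {x : X} (hx : dist (u j) x < tol (A.prec N))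
    {t : List (Fin k)} (hN : t.length ≤ N) (h : Pullable dig s ρ t x) :
    dist (u (A.lift N t j)) (pull s t x) < tol (A.prec (N - t.length)) := by
  induction t with
  | nil => exact hx
  | cons d t ih =>
    rw [List.length_cons] at hN
    have e1 : N - t.length = (N - 1 - t.length) + 1 := by omega
    have e2 : N - (d :: t).length = N - 1 - t.length := by rw [List.length_cons]; omega
    have := ih (by omega) h.1
    rw [e1, prec_succ] at this
    rw [e2]
    exact hA.choice _ _ _ _ h.2 (hA.base_le_prec _) this

/-- Going back along the chain, the gap to the previous element is below half its tolerance and the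
current tolerance is at most the other half. So `x` stays within tolerance of every element of the
chain, and each range test made there transfers to the preimage of `x` itself. -/
theorem pullable_of_mem_nodes (hA : A.IsCorrect dig u s ρ) {C : ℕ → List ℕ} {t : List (Fin k)}
    {i : ℕ} (hi : i ∈ A.nodes C t) {x : X} (hx : dist (u i) x < tol (A.prec t.length)) :
    Pullable dig s ρ t x := by
  induction t generalizing i with
  | nil => trivial
  | cons d t ih =>
    obtain ⟨-, j, hj, h1, h2⟩ := mem_nodes_cons.1 hi
    have hjx : dist (u j) x < tol (A.prec t.length) := by
      have := dist_triangle (u j) (u i) x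
      have := hA.close _ _ _ h2
      have := hA.tol_prec_succ t.length
      rw [List.length_cons] at hx
      linarith
    have hp := ih hj hjx
    have := hA.dist_lift hjx le_rfl hp
    rw [Nat.sub_self] at this
    exact ⟨hp, hA.inside _ _ h1 _ this⟩

/-- The covering supplies the digit and the name supplies the basic element. Both approximate the
same `x`, so their distance is at most 1/8 + 1/16 of the tolerance, within the 1/4 that `close` is
sure to accept. -/
theorem exists_mem_nodes_cons (hA : A.IsCorrect dig u s ρ) {C : ℕ → List ℕ} {K : Set X}
    (hC : ∀ n, ∀ x ∈ K, ∃ j ∈ C n, dist (u j) x < (2 : ℝ)⁻¹ ^ n) {t : List (Fin k)} {x : X}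
    (hx : x ∈ K) {j : ℕ} (hj : j ∈ A.nodes C t)
    (hjx : dist (u j) x < (2 : ℝ)⁻¹ ^ A.nameIdx t.length) :
    ∃ d, ∃ i ∈ A.nodes C (d :: t), dist (u i) x < (2 : ℝ)⁻¹ ^ A.nameIdx (t.length + 1) := by
  obtain ⟨d, hd⟩ := hA.exists_inside (A.lift t.length t j)
  obtain ⟨i, hi, hix⟩ := hC (A.nameIdx (t.length + 1)) x hx
  refine ⟨d, i, mem_nodes_cons.2 ⟨hi, j, hj, hd, hA.close_eq_true _ _ _ ?_⟩, hix⟩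
  have h1 : (2 : ℝ)⁻¹ ^ A.nameIdx t.length ≤ tol (A.prec t.length) / 8 := two_inv_pow_le_tol _
  have h2 : (2 : ℝ)⁻¹ ^ A.nameIdx (t.length + 1) ≤ tol (A.prec (t.length + 1)) / 8 :=
    two_inv_pow_le_tol _
  have h3 := hA.tol_prec_succ t.length
  have h4 := tol_pos (A.prec t.length)
  have := dist_triangle_right (u j) (u i) x
  linarith

theorem exists_pullable_mem (hA : A.IsCorrect dig u s ρ) {C : ℕ → List ℕ} {K : Set X}
    (hC : ∀ n, ∀ x ∈ K, ∃ j ∈ C n, dist (u j) x < (2 : ℝ)⁻¹ ^ n) {x : X} (hx : x ∈ K) (n : ℕ) :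
    ∃ t : List (Fin k), t.length = n ∧ ∃ i ∈ A.nodes C t,
      dist (u i) x < (2 : ℝ)⁻¹ ^ A.nameIdx t.length := by
  induction n with
  | zero =>
    obtain ⟨i, hi, hix⟩ := hC (A.nameIdx 0) x hx
    exact ⟨[], rfl, i, hi, hix⟩
  | succ n ih =>
    obtain ⟨t, rfl, j, hj, hjx⟩ := ih
    obtain ⟨d, i, hi, hix⟩ := hA.exists_mem_nodes_cons hC hx hj hjx
    exact ⟨d :: t, rfl, i, hi, hix⟩

theorem dist_lt_tol (A : Procedures k) {u : ℕ → X} {i n : ℕ} {x : X}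
    (h : dist (u i) x < (2 : ℝ)⁻¹ ^ A.nameIdx n) : dist (u i) x < tol (A.prec n) := by
  have h1 : (2 : ℝ)⁻¹ ^ A.nameIdx n ≤ tol (A.prec n) / 8 := two_inv_pow_le_tol _
  have := tol_pos (A.prec n)
  linarith

theorem isDigitalTree (hA : A.IsCorrect dig u s ρ) {C : ℕ → List ℕ} {K : Set X}
    (hne : ∀ n, C n ≠ []) (hC : ∀ n, ∀ x ∈ K, ∃ j ∈ C n, dist (u j) x < (2 : ℝ)⁻¹ ^ n)
    (hC' : ∀ n, ∀ j ∈ C n, ∃ x ∈ K, dist (u j) x < (2 : ℝ)⁻¹ ^ n) :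
    IsDigitalTree {w | A.tree C w = true} where
  nil_mem := tree_eq_true.2 (List.exists_mem_of_ne_nil _ (hne _))
  prefix_mem w d h := by
    obtain ⟨i, hi⟩ := tree_eq_true.1 h
    rw [List.reverse_append] at hi
    obtain ⟨-, j, hj, -⟩ := mem_nodes_cons.1 hi
    exact tree_eq_true.2 ⟨j, hj⟩
  extend w h := by
    obtain ⟨j, hj⟩ := tree_eq_true.1 h
    obtain ⟨x, hx, hjx⟩ := hC' _ j (mem_of_mem_nodes hj)
    obtain ⟨d, i, hi, -⟩ := hA.exists_mem_nodes_cons hC hx hj hjx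
    exact ⟨d, tree_eq_true.2 ⟨i, by rwa [List.reverse_append]⟩⟩

theorem subset_treeValue (hA : A.IsCorrect dig u s ρ) {C : ℕ → List ℕ} {K : Set X}
    (hC : ∀ n, ∀ x ∈ K, ∃ j ∈ C n, dist (u j) x < (2 : ℝ)⁻¹ ^ n) :
    K ⊆ treeValue dig {w | A.tree C w = true} := by
  intro x hx
  refine mem_iInter.2 fun n => ?_
  obtain ⟨t, rfl, i, hi, hix⟩ := hA.exists_pullable_mem hC hx n
  refine mem_iUnion₂.2 ⟨t.reverse, ⟨tree_eq_true.2 ⟨i, by rwa [List.reverse_reverse]⟩,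
    List.length_reverse⟩, pull s t x, hA.wordMap_pull ?_⟩
  exact hA.pullable_of_mem_nodes hi (dist_lt_tol A hix)

/-- The node certifying a word is near some `y` in `K`, and `y` lies exactly in the range of the
word, whose diameter is below ε. -/
theorem treeValue_subset (hA : A.IsCorrect dig u s ρ) {C : ℕ → List ℕ} {K : Set X}
    (hK : IsClosed K) (hC' : ∀ n, ∀ j ∈ C n, ∃ x ∈ K, dist (u j) x < (2 : ℝ)⁻¹ ^ n)
    (hdiam : ∀ ε > 0, ∃ n, ∀ w : List (Fin k), w.length = n →
      ∀ x y, dist (wordMap dig w x) (wordMap dig w y) < ε) :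
    treeValue dig {w | A.tree C w = true} ⊆ K := by
  intro x hx
  rw [← hK.closure_eq]
  refine Metric.mem_closure_iff.2 fun ε hε => ?_
  obtain ⟨n, hn⟩ := hdiam ε hε
  obtain ⟨w, ⟨hw, rfl⟩, z, rfl⟩ := mem_iUnion₂.1 (mem_iInter.1 hx n)
  obtain ⟨j, hj⟩ := tree_eq_true.1 hw
  obtain ⟨y, hy, hjy⟩ := hC' _ j (mem_of_mem_nodes hj)
  refine ⟨y, hy, ?_⟩
  have h := hA.wordMap_pull (hA.pullable_of_mem_nodes hj (dist_lt_tol A hjy))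
  rw [List.reverse_reverse] at h
  rw [← h]
  exact hn w rfl _ _

end IsCorrect

end Procedures

end DigitSpace

namespace DigitSpace

/-! ### Compactness of digit spaces -/

variable {X : Type*} [MetricSpace X] {k : ℕ}

open Filter Topology in
theorem tendsto_tol : Tendsto tol atTop (𝓝 0) := tendsto_one_div_add_atTop_nhds_zero_nat

theorem posRat_zero (n : ℕ) : posRat (0, n) = tol n := by simp [posRat, tol]

theorem tol_le_posRat (p : ℕ × ℕ) : tol p.2 ≤ posRat p := by
  unfold tol posRat
  gcongr
  simp

namespace IsDigitSpace

variable {dig : Fin k → X → X}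

open Filter Topology in
theorem exists_uniform_contraction (h : IsDigitSpace dig) :
    ∃ q : ℝ, 0 < q ∧ q < 1 ∧ ∀ i x y, dist (dig i x) (dig i y) ≤ q * dist x y := by
  choose r hr hd using h.contraction
  have h1 : ∀ᶠ q in 𝓝[<] (1 : ℝ), ∀ i, r i ≤ q :=
    eventually_all.2 fun i => mem_of_superset (Ioo_mem_nhdsLT (hr i)) fun _ hq => hq.1.le
  obtain ⟨q, hq, hq0, hq1⟩ := (h1.and (Ioo_mem_nhdsLT (zero_lt_one' ℝ))).exists
  exact ⟨q, hq0, hq1, fun i x y =>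
    (hd i x y).trans (mul_le_mul_of_nonneg_right (hq i) dist_nonneg)⟩

theorem dist_dig_le (h : IsDigitSpace dig) (i : Fin k) (x y : X) :
    dist (dig i x) (dig i y) ≤ dist x y := by
  obtain ⟨q, hq, hd⟩ := h.contraction i
  exact (hd x y).trans (mul_le_of_le_one_left dist_nonneg hq.le)

theorem continuous_dig (h : IsDigitSpace dig) (i : Fin k) : Continuous (dig i) :=
  (LipschitzWith.of_dist_le_mul (K := 1) fun x y => by simpa using h.dist_dig_le i x y).continuous

theorem exists_dist_wordMap_lt (h : IsDigitSpace dig) {ε : ℝ} (hε : 0 < ε) :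
    ∃ n, ∀ w : List (Fin k), w.length = n →
      ∀ x y, dist (wordMap dig w x) (wordMap dig w y) < ε := by
  obtain ⟨q, hq0, hq1, hq⟩ := h.exists_uniform_contraction
  obtain ⟨M, hM⟩ := h.bounded
  have hpos : 0 < |M| + 1 := by positivity
  have key : ∀ (w : List (Fin k)) x y,
      dist (wordMap dig w x) (wordMap dig w y) ≤ q ^ w.length * dist x y := by
    intro w x y
    induction w with
    | nil => simp [wordMap]
    | cons i w ih =>
      calc dist (dig i (wordMap dig w x)) (dig i (wordMap dig w y))
          ≤ q * dist (wordMap dig w x) (wordMap dig w y) := hq _ _ _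
        _ ≤ q * (q ^ w.length * dist x y) := by gcongr
        _ = q ^ (i :: w).length * dist x y := by rw [List.length_cons]; ring
  obtain ⟨n, hn⟩ := exists_pow_lt_of_lt_one (div_pos hε hpos) hq1
  refine ⟨n, fun w hw x y => ?_⟩
  calc dist (wordMap dig w x) (wordMap dig w y) ≤ q ^ w.length * dist x y := key w x y
    _ ≤ q ^ n * (|M| + 1) := by
      rw [hw]
      gcongr
      linarith [hM x y, le_abs_self M]
    _ < ε := (lt_div_iff₀ hpos).1 hn

theorem exists_mem_range_wordMap (h : IsDigitSpace dig) (n : ℕ) (x : X) :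
    ∃ w : List (Fin k), w.length = n ∧ x ∈ range (wordMap dig w) := by
  induction n generalizing x with
  | zero => exact ⟨[], rfl, x, rfl⟩
  | succ n ih =>
    obtain ⟨i, y, rfl⟩ := mem_iUnion.1 (h.cover.symm ▸ mem_univ x : x ∈ ⋃ i, range (dig i))
    obtain ⟨w, hw, z, rfl⟩ := ih y
    exact ⟨i :: w, by rw [List.length_cons, hw], z, rfl⟩

/-- One point from the range of each word of length `n` gives a finite ε-net. -/
theorem compactSpace (h : IsDigitSpace dig) : CompactSpace X := by
  have := h.complete
  obtain ⟨x₀⟩ := h.nonempty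
  refine ⟨isCompact_iff_totallyBounded_isComplete.2 ⟨?_, isComplete_univ⟩⟩
  refine Metric.totallyBounded_iff.2 fun ε hε => ?_
  obtain ⟨n, hn⟩ := h.exists_dist_wordMap_lt hε
  refine ⟨(fun w => wordMap dig w x₀) '' {w | w.length = n},
    (List.finite_length_eq _ n).image _, fun x _ => ?_⟩
  obtain ⟨w, hw, z, rfl⟩ := h.exists_mem_range_wordMap n x
  exact mem_iUnion₂.2 ⟨_, mem_image_of_mem _ hw, hn w hw _ _⟩

/-- The set of all nonempty compact sets is itself closed under the coinductive clause, with the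
nonempty preimages d⁻¹[A] as components. -/
theorem CK_eq_univ (h : IsDigitSpace dig) : CK dig = univ := by
  have := h.compactSpace
  refine univ_subset_iff.1 (subset_sUnion_of_mem fun A _ => ?_)
  refine ⟨{d | (dig d ⁻¹' (A : Set X)).Nonempty}, fun d => ⟨⟨dig d ⁻¹' (A : Set X),
    (A.isCompact.isClosed.preimage (h.continuous_dig d)).isCompact⟩, d.2⟩, ?_, fun _ => mem_univ _⟩
  refine subset_antisymm (fun x hx => ?_) (iUnion_subset fun d => image_preimage_subset _ _)
  obtain ⟨d, y, rfl⟩ := mem_iUnion.1 (h.cover.symm ▸ mem_univ x : x ∈ ⋃ i, range (dig i))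
  exact mem_iUnion.2 ⟨⟨d, y, hx⟩, y, hx, rfl⟩

end IsDigitSpace

/-! ### Names, exact preimages and the component procedures -/

theorem IsHausdorffName.exists_of_mem {u : ℕ → X} {C : ℕ → List ℕ} {K : NonemptyCompacts X}
    (h : IsHausdorffName u C K) (n : ℕ) :
    (∀ x ∈ (K : Set X), ∃ j ∈ C n, dist (u j) x < (2 : ℝ)⁻¹ ^ n) ∧
      ∀ j ∈ C n, ∃ x ∈ (K : Set X), dist (u j) x < (2 : ℝ)⁻¹ ^ n := by
  obtain ⟨hne, hd⟩ := h n
  have hfin : (basicSet u (C n)).Finite := by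
    refine ((C n).finite_toSet.image u).subset ?_
    rintro x ⟨j, hj, rfl⟩
    exact mem_image_of_mem u hj
  obtain ⟨j₀, hj₀⟩ := List.exists_mem_of_ne_nil _ hne
  have hmem : ∀ j ∈ C n, u j ∈ basicSet u (C n) := fun j hj => ⟨j, hj, rfl⟩
  -- An infinite extended distance would make `hausdorffDist` zero and the bound `hd` void;
  -- nonemptiness and boundedness exclude this.
  have htop := Metric.hausdorffEDist_ne_top_of_nonempty_of_bounded K.nonempty
    ⟨_, hmem _ hj₀⟩ K.isCompact.isBounded hfin.isBounded
  constructor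
  · intro x hx
    obtain ⟨-, ⟨j, hj, rfl⟩, hxj⟩ := Metric.exists_dist_lt_of_hausdorffDist_lt hx hd htop
    exact ⟨j, hj, by rwa [dist_comm]⟩
  · intro j hj
    obtain ⟨x, hx, hxj⟩ := Metric.exists_dist_lt_of_hausdorffDist_lt' (hmem j hj) hd htop
    exact ⟨x, hx, by rwa [dist_comm]⟩

open Filter Topology in
/-- Approximate preimages of basic elements determine exact preimages of their limits. -/
theorem exists_preimage_of_approx [CompactSpace X] {u : ℕ → X} {f : X → X} (hf : Continuous f)
    {R : Set ℕ} {v : ℕ → ℕ → ℕ} {m : ℕ → ℕ}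
    (h1 : ∀ n n', ∀ j ∈ R, dist (u (v n j)) (u (v n' j)) < max (tol n) (tol n'))
    (h2 : ∀ n, ∀ j ∈ R, ∀ j' ∈ R, dist (u j) (u j') < tol (m n) →
      dist (u (v n j)) (u (v n j')) < tol n)
    (h3 : ∀ n, ∀ j ∈ R, dist (f (u (v n j))) (u j) < tol n)
    {x : X} (hx : ∀ ε > 0, ∃ j ∈ R, dist (u j) x < ε) :
    ∃ z, f z = x ∧ ∀ n, ∀ j ∈ R, dist (u j) x < tol (m (3 * n + 2)) →
      dist (u (v (3 * n + 2) j)) z < tol n := by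
  choose a haR ha using fun i => hx (tol i) (tol_pos i)
  -- The exact preimage is a cluster point of ever finer approximate preimages of basic elements
  -- tending to `x`.
  obtain ⟨z, φ, hφ, hz⟩ := CompactSpace.tendsto_subseq fun i => u (v i (a i))
  have hφt : Tendsto (fun i => tol (φ i)) atTop (𝓝 0) := tendsto_tol.comp hφ.tendsto_atTop
  refine ⟨z, ?_, fun n j hj hjx => ?_⟩
  · refine tendsto_nhds_unique ((hf.tendsto z).comp hz) (tendsto_iff_dist_tendsto_zero.2 ?_)
    have h0 : Tendsto (fun i => tol (φ i) + tol (φ i)) atTop (𝓝 0) := by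
      simpa using hφt.add hφt
    refine squeeze_zero (fun _ => dist_nonneg) (fun i => ?_) h0
    exact (dist_triangle _ (u (a (φ i))) _).trans (add_le_add (h3 _ _ (haR _)).le (ha _).le)
  -- One error comes from changing the basic element (`h2`), one from changing the precision (`h1`);
  -- each is a third of `tol n`, leaving strict room.
  · have hlim : dist (u (v (3 * n + 2) j)) z ≤ tol (3 * n + 2) + tol (3 * n + 2) := by
      refine le_of_tendsto (tendsto_const_nhds.dist hz) ?_
      filter_upwards [hφt.eventually_lt_const (sub_pos.2 hjx),
        hφ.tendsto_atTop.eventually_ge_atTop (3 * n + 2)] with i hi hi'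
      have hd : dist (u j) (u (a (φ i))) < tol (m (3 * n + 2)) := by
        have := dist_triangle_right (u j) (u (a (φ i))) x
        have := ha (φ i)
        linarith
      have := h1 (3 * n + 2) (φ i) _ (haR (φ i))
      rw [max_eq_left (tol_anti hi')] at this
      exact (dist_triangle _ (u (v (3 * n + 2) (a (φ i)))) _).trans
        (add_le_add (h2 _ _ hj _ (haR _) hd).le this.le)
    have e : tol (3 * n + 2) = tol n / 3 := by
      unfold tol
      push_cast
      field_simp
      ring
    have := tol_pos n
    linarith

/-- Distances of basic elements can be compared up to a factor of two. -/
theorem IsComputableMetric.exists_close {u : ℕ → X} (h : IsComputableMetric u) :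
    ∃ c : ℕ × ℕ × ℕ → Bool, Computable c ∧ ∀ i j n,
      (c (i, j, n) = true → dist (u i) (u j) < tol n / 2) ∧
      (dist (u i) (u j) ≤ tol n / 4 → c (i, j, n) = true) := by
  have hc (a b : ℕ) : Computable fun p : ℕ × ℕ × ℕ =>
      ((p.1, p.2.1, (1, 0, a * p.2.2 + b)) : ℕ × ℕ × (ℕ × ℕ × ℕ)) :=
    (Primrec.fst.pair ((Primrec.fst.comp .snd).pair ((Primrec.const 1).pair ((Primrec.const 0).pair
      (Primrec.nat_add.comp (Primrec.nat_mul.comp (.const a) (Primrec.snd.comp .snd))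
        (.const b)))))).to_comp
  have hlt := Partrec.comp h.lt (hc 2 1)
  have hgt := Partrec.comp h.gt (hc 4 3)
  have e2 (n : ℕ) : ratOf (1, 0, 2 * n + 1) = tol n / 2 := by
    simp only [ratOf, tol]
    push_cast
    field_simp
    ring
  have e4 (n : ℕ) : ratOf (1, 0, 4 * n + 3) = tol n / 4 := by
    simp only [ratOf, tol]
    push_cast
    field_simp
    ring
  obtain ⟨c, hcc, hcs⟩ := REPred.exists_computable_selector
    (p := fun p : ℕ × ℕ × ℕ => dist (u p.1) (u p.2.1) < ratOf (1, 0, 2 * p.2.2 + 1))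
    (q := fun p : ℕ × ℕ × ℕ => dist (u p.1) (u p.2.1) > ratOf (1, 0, 4 * p.2.2 + 3))
    hlt hgt fun p => by
      rw [e2, e4]
      have := tol_pos p.2.2
      by_cases hp : dist (u p.1) (u p.2.1) < tol p.2.2 / 2
      · exact .inl hp
      · exact .inr (by linarith)
  refine ⟨c, hcc, fun i j n => ⟨fun ht => e2 n ▸ (hcs _).1 ht, fun hd => ?_⟩⟩
  by_contra hf
  have := (hcs _).2 (Bool.eq_false_iff.2 hf)
  rw [e4] at this
  exact absurd hd (not_le.2 this)

theorem IsDecidable.exists_inside {dig : Fin k → X → X} {u : ℕ → X} (h : IsDecidable dig u)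
    (c : ℕ) : ∃ b : ℕ × Fin k → Bool, Computable b ∧
      ∀ j d, b (j, d) = true ↔ Metric.ball (u j) (tol c) ⊆ range (dig d) := by
  obtain ⟨f, hf, he⟩ := ComputablePred.computable_iff.1 h
  refine ⟨fun p => f (p.1, (0, c), p.2), hf.comp (Computable.fst.pair
    ((Computable.const (0, c)).pair .snd)), fun j d => ?_⟩
  have := congrFun he (j, (0, c), d)
  rw [← posRat_zero]
  exact (iff_of_eq this).symm

/-- Approximable choice, restricted to basic elements that lie well inside the range of the digit,
made total and uniform in the digit. -/
theorem ApproximableChoice.exists_total {dig : Fin k → X → X} {u : ℕ → X}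
    (h : ApproximableChoice dig u) {b : ℕ × Fin k → Bool} (hb : Computable b)
    (hbr : ∀ j d, b (j, d) = true → u j ∈ range (dig d)) :
    ∃ (v : Fin k × ℕ × ℕ → ℕ) (m : ℕ → ℕ), Computable v ∧ Computable m ∧ ∀ d,
      (∀ n n' j, b (j, d) = true →
        dist (u (v (d, n, j))) (u (v (d, n', j))) < max (tol n) (tol n')) ∧
      (∀ n j j', b (j, d) = true → b (j', d) = true → dist (u j) (u j') < tol (m n) →
        dist (u (v (d, n, j))) (u (v (d, n, j'))) < tol n) ∧
      ∀ n j, b (j, d) = true → ∃ z, dig d z = u j ∧ dist z (u (v (d, n, j))) < tol n := by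
  choose v₀ hv₀ hdom hcauchy hmod hpre using h
  choose m₀ hm₀ hmod using hmod
  have hv₁ : Partrec fun p : Fin k × ℕ × ℕ => v₀ p.1 ((0, p.2.1), p.2.2) :=
    (Partrec.of_finite_family hv₀).comp (Computable.fst.pair
      (((Computable.const 0).pair (Computable.fst.comp .snd)).pair (Computable.snd.comp .snd)))
  have hv₂ : Partrec fun p : Fin k × ℕ × ℕ =>
      bif b (p.2.2, p.1) then v₀ p.1 ((0, p.2.1), p.2.2) else Part.some 0 :=
    Partrec.cond (hb.comp ((Computable.snd.comp .snd).pair .fst)) hv₁ (Computable.const 0).partrec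
  -- The decidable guard `b` confines calls to arguments where `v₀` halts; elsewhere the value 0 is
  -- arbitrary.
  have htot : ∀ p : Fin k × ℕ × ℕ, ∃ a : ℕ,
      a ∈ (bif b (p.2.2, p.1) then v₀ p.1 ((0, p.2.1), p.2.2) else Part.some 0) := by
    rintro ⟨d, n, j⟩
    cases hj : b (j, d) with
    | false => exact ⟨0, by simp⟩
    | true => simpa [hj] using Part.dom_iff_mem.1 (hdom d (0, n) j (hbr j d hj))
  choose v hv using htot
  have hmem : ∀ d n j, b (j, d) = true → v (d, n, j) ∈ v₀ d ((0, n), j) := fun d n j hj => by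
    simpa [hj] using hv (d, n, j)
  -- The sum over all digits is a single modulus dominating each of theirs.
  have hsum : ∀ d n, (m₀ d (0, n)).2 ≤ (List.ofFn fun d => (m₀ d (0, n)).2).foldr (· + ·) 0 := by
    intro d n
    rw [← List.sum_eq_foldr, List.sum_ofFn]
    exact Finset.single_le_sum (f := fun d => (m₀ d (0, n)).2) (fun _ _ => Nat.zero_le _)
      (Finset.mem_univ d)
  refine ⟨v, fun n => (List.ofFn fun d => (m₀ d (0, n)).2).foldr (· + ·) 0, hv₂.of_eq_tot hv, ?_,
    fun d => ⟨fun n n' j hj => ?_, fun n j j' hj hj' hd => ?_, fun n j hj => ?_⟩⟩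
  · exact Computable.list_foldr (Computable.list_ofFn fun d =>
      Computable.snd.comp ((hm₀ d).comp ((Computable.const 0).pair .id))) (.const 0)
      (Primrec.nat_add.to_comp.comp (Computable.fst.comp .snd) (Computable.snd.comp .snd)).to₂
  · simpa only [posRat_zero] using
      hcauchy d (0, n) (0, n') j (hbr j d hj) _ (hmem d n j hj) _ (hmem d n' j hj)
  · rw [← posRat_zero]
    exact hmod d (0, n) j j' (hbr j d hj) (hbr j' d hj')
      (hd.trans_le ((tol_anti (hsum d n)).trans (tol_le_posRat _))) _ (hmem d n j hj) _
      (hmem d n j' hj')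
  · rw [← posRat_zero]
    exact hpre d (0, n) j (hbr j d hj) _ (hmem d n j hj)

/-- Three radii interact: a point passing the test has a ball of radius `tol c` in the range, points
within `tol c / 4` of it keep radius ρ = `tol c / 2`, and basic elements within `tol c / 4` of those
still pass the guard of radius `tol N` ≤ `tol c / 4`. -/
theorem exists_procedures {dig : Fin k → X → X} {u : ℕ → X} (hX : IsDigitSpace dig)
    (hu : IsComputableMetric u) (hwc : WellCovering dig) (hdec : IsDecidable dig u)
    (hac : ApproximableChoice dig u) :
    ∃ A : Procedures k, A.IsComputable ∧ ∃ s ρ, A.IsCorrect dig u s ρ := by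
  have := hX.compactSpace
  obtain ⟨δ, hδ, hleb⟩ := lebesgue_number_lemma_of_metric (isCompact_univ (X := X))
    (fun i => isOpen_interior (s := range (dig i))) fun x _ => mem_iUnion.2 (hwc x)
  obtain ⟨c, hcδ⟩ := exists_tol_lt hδ
  have hbase : tol (2 * (2 * c + 1) + 1) ≤ tol c / 4 := by
    have h1 := tol_le_half (le_refl (2 * (2 * c + 1) + 1))
    have h2 := tol_le_half (le_refl (2 * c + 1))
    linarith
  have hc0 := tol_pos c
  set N := 2 * (2 * c + 1) + 1
  obtain ⟨cl, hcl, hcls⟩ := hu.exists_close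
  obtain ⟨b, hb, hbs⟩ := hdec.exists_inside c
  obtain ⟨g, hg, hgs⟩ := hdec.exists_inside N
  obtain ⟨v, m, hv, hm, hvm⟩ := hac.exists_total hg
    fun j d hj => (hgs j d).1 hj (Metric.mem_ball_self (tol_pos _))
  have hguard : ∀ d x, Metric.ball x (tol c / 2) ⊆ range (dig d) →
      ∀ j, dist (u j) x < tol c / 4 → g (j, d) = true := by
    intro d x hx j hj
    refine (hgs j d).2 fun y hy => hx ?_
    rw [Metric.mem_ball] at hy ⊢
    have := dist_triangle y (u j) x
    linarith
  have hsec : ∀ d x, ∃ z, Metric.ball x (tol c / 2) ⊆ range (dig d) → dig d z = x ∧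
      ∀ n j, g (j, d) = true → dist (u j) x < tol (m (3 * n + 2)) →
        dist (u (v (d, 3 * n + 2, j))) z < tol n := by
    intro d x
    by_cases hx : Metric.ball x (tol c / 2) ⊆ range (dig d)
    · obtain ⟨h1, h2, h3⟩ := hvm d
      have h3' : ∀ n, ∀ j ∈ {j | g (j, d) = true},
          dist (dig d (u (v (d, n, j)))) (u j) < tol n := fun n j hj => by
        obtain ⟨y, hy, hyd⟩ := h3 n j hj
        rw [← hy, dist_comm]
        exact (hX.dist_dig_le d _ _).trans_lt hyd
      have hclose : ∀ ε > 0, ∃ j ∈ {j | g (j, d) = true}, dist (u j) x < ε := fun ε hε => by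
        obtain ⟨j, hj⟩ := hu.dense.exists_dist_lt x (lt_min hε (by positivity : 0 < tol c / 4))
        rw [dist_comm] at hj
        exact ⟨j, hguard d x hx j (hj.trans_le (min_le_right _ _)), hj.trans_le (min_le_left _ _)⟩
      obtain ⟨z, hz, hz'⟩ := exists_preimage_of_approx (hX.continuous_dig d)
        (v := fun n j => v (d, n, j)) h1 (fun n j hj j' hj' => h2 n j j' hj hj') h3' hclose
      exact ⟨z, fun _ => ⟨hz, hz'⟩⟩
    · exact ⟨x, fun h => absurd h hx⟩
  choose s hs using hsec
  have h32 : Computable fun n : ℕ => 3 * n + 2 :=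
    (Primrec.nat_add.comp (Primrec.nat_mul.comp (.const 3) .id) (.const 2)).to_comp
  have h21 : Computable fun n : ℕ => 2 * n + 1 :=
    (Primrec.nat_add.comp (Primrec.nat_mul.comp (.const 2) .id) (.const 1)).to_comp
  -- In the modulus, the summand `2 * n + 1` halves the tolerance and `m (3 * n + 2)` gives the
  -- closeness required by `hs`.
  refine ⟨⟨fun p => v (p.1, 3 * p.2.1 + 2, p.2.2), fun n => 2 * n + 1 + m (3 * n + 2), b, cl, N⟩,
    ⟨hv.comp (Computable.fst.pair ((h32.comp (Computable.fst.comp .snd)).pair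
      (Computable.snd.comp .snd))), Primrec.nat_add.to_comp.comp h21 (hm.comp h32), hb, hcl⟩,
    s, tol c / 2, ⟨fun d x hx => (hs d x hx).1, fun d n j x hx hn hd => ?_, fun n => by simp,
      fun j d hj x hx => ?_, fun j => ?_, fun i j n => (hcls i j n).1, fun i j n => (hcls i j n).2⟩⟩
  · dsimp only at hn hd ⊢
    refine (hs d x hx).2 n j (hguard d x hx j (hd.trans_le ?_)) (hd.trans_le (tol_anti (by simp)))
    exact (tol_anti (by omega)).trans hbase
  · refine Subset.trans (fun y hy => ?_) ((hbs j d).1 hj)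
    dsimp only at hx
    rw [Metric.mem_ball] at hy ⊢
    have := dist_triangle_right y (u j) x
    linarith
  · obtain ⟨d, hd⟩ := hleb (u j) (mem_univ _)
    exact ⟨d, (hbs j d).2 ((Metric.ball_subset_ball hcδ.le).trans (hd.trans interior_subset))⟩

end DigitSpace

theorem mainTheorem1 {X : Type*} [MetricSpace X] {k : ℕ} (dig : Fin k → X → X) (u : ℕ → X)
    (hX : DigitSpace.IsComputableDigitSpace dig u)
    (hwc : DigitSpace.WellCovering dig)
    (hdec : DigitSpace.IsDecidable dig u)
    (hac : DigitSpace.ApproximableChoice dig u) :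
    DigitSpace.AK u ⊆ DigitSpace.CK dig ∧
    ∃ J : (ℕ → List ℕ) → List (Fin k) → Bool,
      DigitSpace.ComputableOperatorOn {C | ∃ K, DigitSpace.IsHausdorffName u C K} J ∧
      ∀ (C : ℕ → List ℕ) (K : TopologicalSpace.NonemptyCompacts X),
        DigitSpace.IsHausdorffName u C K →
          DigitSpace.IsDigitalTree {w | J C w = true} ∧
          DigitSpace.treeValue dig {w | J C w = true} = (K : Set X) := by
  refine ⟨?_, ?_⟩
  · rw [hX.digitSpace.CK_eq_univ]
    exact subset_univ _
  obtain ⟨A, hA, s, ρ, hs⟩ :=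
    DigitSpace.exists_procedures hX.digitSpace hX.metric hwc hdec hac
  refine ⟨A.tree, DigitSpace.Procedures.computableOperatorOn_tree hA
    (fun n => by have := hs.modulus n; omega) _, fun C K hC => ?_⟩
  have h1 := fun n => (hC.exists_of_mem n).1
  have h2 := fun n => (hC.exists_of_mem n).2
  exact ⟨hs.isDigitalTree (fun n => (hC n).1) h1 h2, subset_antisymm
    (hs.treeValue_subset K.isCompact.isClosed h2 fun _ => hX.digitSpace.exists_dist_wordMap_lt)
    (hs.subset_treeValue h1)⟩
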